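/- Let $\alpha>-1/2$. Put $d\mu_\alpha(x)=(2\pi)^{\alpha+1}x^{2\alpha+1}\,dx$ on $\mathbb R^+$, $L^2_\alpha=L^2(\mathbb R^+,\mu_\alpha)$, and $$j_\alpha(x)=\frac{J_\alpha(x)}{x^\alpha}=\frac1{2^\alpha}\sum_{n\ge0}\frac{(-1)^n}{n!\,\Gamma(n+\alpha+1)}\Big(\frac x2\Big)^{2n}.$$ Let $\mathcal F_\alpha$ be the Fourier--Bessel transform, i.e. the unitary operator of $L^2_\alpha$ that extends $\mathcal F_\alpha f(y)=\int_0^\infty f(x)j_\alpha(2\pi xy)\,d\mu_\alpha(x)$ from $L^1_\alpha\cap L^2_\alpha$. For measurable $A\subset\mathbb R^+$ let $E_A$ and $F_A$ be the orthogonal projections of $L^2_\alpha$ given by $E_Af=\chi_Af$ and $\mathcal F_\alpha(F_Af)=\chi_A\mathcal F_\alpha f$; write $A^c=\mathbb R^+\setminus A$ and $|A|$ for the Lebesgue measure of $A$, and $\|\cdot\|_{HS}$ for the Hilbert--Schmidt norm. There is a constant $\kappa_\alpha$, depending only on $\alpha$, such that $|j_\alpha(t)|\le\kappa_\alpha t^{-\alpha-1/2}$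 for all $t>0$. For every such constant $\kappa_\alpha$ and all measurable $S,\Sigma\subset\mathbb R^+$ of finite Lebesgue measure, $$\|F_\Sigma E_S\|_{HS}\le\kappa_\alpha\sqrt{2\pi|S||\Sigma|}.$$ In particular, if $|S||\Sigma|<\frac1{2\pi}\kappa_\alpha^{-2}$, then for all $f\in L^2_\alpha$, $$\|f\|_{L^2_\alpha}\le\Big(1+\frac1{1-\kappa_\alpha\sqrt{2\pi|S||\Sigma|}}\Big)\Big(\|E_{S^c}f\|_{L^2_\alpha}+\|F_{\Sigma^c}f\|_{L^2_\alpha}\Big).$$ -/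

import Mathlib

open MeasureTheory
open scoped ENNReal

noncomputable section

namespace FourierBessel

/-- The normalized Bessel function `j_α(x) = J_α(x) / x^α`, given by its power series
`2^{-α} ∑ (-1)^n / (n! Γ(n+α+1)) (x/2)^{2n}`. -/
def besselj (α x : ℝ) : ℝ :=
  (1 / (2 : ℝ) ^ α) *
    ∑' n : ℕ, (-1 : ℝ) ^ n / ((n.factorial : ℝ) * Real.Gamma ((n : ℝ) + α + 1)) * (x / 2) ^ (2 * n)

/-- `κ` is an admissible constant in the bound `|j_α(t)| ≤ κ t^{-α-1/2}`, `t > 0`. -/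
def BesselBound (α κ : ℝ) : Prop :=
  ∀ t : ℝ, 0 < t → |besselj α t| ≤ κ * t ^ (-α - 1 / 2)

/-- The measure `dμ_α(x) = (2π)^{α+1} x^{2α+1} dx` on `(0, ∞)`, seen as a measure on `ℝ`
that is concentrated on `(0, ∞)`. -/
def muAlpha (α : ℝ) : Measure ℝ :=
  (volume.restrict (Set.Ioi (0 : ℝ))).withDensity
    (fun x => ENNReal.ofReal ((2 * Real.pi) ^ (α + 1) * x ^ (2 * α + 1)))

/-- The Hilbert space `L²_α(ℝ⁺)` of complex-valued functions. -/
abbrev L2 (α : ℝ) : Type := Lp ℂ 2 (muAlpha α)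

/-- The Fourier-Bessel (Hankel) transform of an integrable function, as an integral. -/
def fourierBesselIntegral (α : ℝ) (f : ℝ → ℂ) (y : ℝ) : ℂ :=
  ∫ x, f x * (besselj α (2 * Real.pi * x * y) : ℂ) ∂(muAlpha α)

/-- `U` is a unitary operator of `L²_α` that is given by the integral on `L¹_α ∩ L²_α`.
Since `L¹_α ∩ L²_α` is dense in `L²_α`, there is at most one such `U`. -/
def IsFourierBessel (α : ℝ) (U : L2 α ≃ₗᵢ[ℂ] L2 α) : Prop :=
  ∀ f : L2 α, Integrable (f : ℝ → ℂ) (muAlpha α) →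
    (U f : ℝ → ℂ) =ᵐ[muAlpha α] fourierBesselIntegral α f

open Classical in
/-- The Fourier-Bessel transform on `L²_α`: the unitary extension of the integral transform from
`L¹_α ∩ L²_α` to `L²_α`. (For `α > -1/2` this extension exists by Plancherel's theorem; the
identity is a default value, used only if there were no such extension.) -/
def fourierBessel (α : ℝ) : L2 α ≃ₗᵢ[ℂ] L2 α :=
  if h : ∃ U : L2 α ≃ₗᵢ[ℂ] L2 α, IsFourierBessel α U then h.choose
  else LinearIsometryEquiv.refl ℂ (L2 α)

/-- The class of `χ_S f` in `L²(μ)`, for `f ∈ L²(μ)`. -/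
def chiMul {μ : Measure ℝ} (S : Set ℝ) (hS : MeasurableSet S) (f : Lp ℂ 2 μ) : Lp ℂ 2 μ :=
  ((Lp.memLp f).indicator hS).toLp (S.indicator f)

theorem coeFn_chiMul {μ : Measure ℝ} (S : Set ℝ) (hS : MeasurableSet S) (f : Lp ℂ 2 μ) :
    (chiMul S hS f : ℝ → ℂ) =ᵐ[μ] S.indicator f :=
  MemLp.coeFn_toLp _

theorem chiMul_add {μ : Measure ℝ} (S : Set ℝ) (hS : MeasurableSet S) (f g : Lp ℂ 2 μ) :
    chiMul S hS (f + g) = chiMul S hS f + chiMul S hS g := by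
  apply Lp.ext
  filter_upwards [coeFn_chiMul S hS (f + g), coeFn_chiMul S hS f, coeFn_chiMul S hS g,
    Lp.coeFn_add f g, Lp.coeFn_add (chiMul S hS f) (chiMul S hS g)] with x h1 h2 h3 h4 h5
  rw [h1, h5, Pi.add_apply, h2, h3]
  by_cases hx : x ∈ S
  · rw [Set.indicator_of_mem hx, Set.indicator_of_mem hx, Set.indicator_of_mem hx, h4,
      Pi.add_apply]
  · rw [Set.indicator_of_notMem hx, Set.indicator_of_notMem hx, Set.indicator_of_notMem hx,
      add_zero]

theorem chiMul_smul {μ : Measure ℝ} (S : Set ℝ) (hS : MeasurableSet S) (c : ℂ) (f : Lp ℂ 2 μ) :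
    chiMul S hS (c • f) = c • chiMul S hS f := by
  apply Lp.ext
  filter_upwards [coeFn_chiMul S hS (c • f), coeFn_chiMul S hS f,
    Lp.coeFn_smul c f, Lp.coeFn_smul c (chiMul S hS f)] with x h1 h2 h3 h4
  rw [h1, h4, Pi.smul_apply, h2]
  by_cases hx : x ∈ S
  · rw [Set.indicator_of_mem hx, Set.indicator_of_mem hx, h3, Pi.smul_apply]
  · rw [Set.indicator_of_notMem hx, Set.indicator_of_notMem hx, smul_zero]

theorem norm_chiMul_le {μ : Measure ℝ} (S : Set ℝ) (hS : MeasurableSet S) (f : Lp ℂ 2 μ) :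
    ‖chiMul S hS f‖ ≤ 1 * ‖f‖ := by
  rw [one_mul]
  apply Lp.norm_le_norm_of_ae_le
  filter_upwards [coeFn_chiMul S hS f] with x h1
  rw [h1]
  exact norm_indicator_le_norm_self _ _

/-- The projection `E_S f = χ_S f` on `L²_α`. -/
def projE (α : ℝ) (S : Set ℝ) (hS : MeasurableSet S) : L2 α →L[ℂ] L2 α :=
  LinearMap.mkContinuous
    { toFun := chiMul S hS
      map_add' := chiMul_add S hS
      map_smul' := chiMul_smul S hS }
    1 (norm_chiMul_le S hS)

/-- The projection `F_Σ` on `L²_α`, determined by `ℱ_α (F_Σ f) = χ_Σ ℱ_α(f)`. -/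
def projF (α : ℝ) (S : Set ℝ) (hS : MeasurableSet S) : L2 α →L[ℂ] L2 α :=
  ((fourierBessel α).symm.toContinuousLinearEquiv : L2 α →L[ℂ] L2 α) ∘L projE α S hS ∘L
    ((fourierBessel α).toContinuousLinearEquiv : L2 α →L[ℂ] L2 α)

theorem fourierBessel_projF (α : ℝ) (S : Set ℝ) (hS : MeasurableSet S) (f : L2 α) :
    fourierBessel α (projF α S hS f) = projE α S hS (fourierBessel α f) := by
  simp [projF]

/-- The Hilbert-Schmidt norm `(∑ ‖T e_i‖²)^{1/2}` of a bounded operator, computed in the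
orthonormal (Hilbert) basis `b = (e_i)`; it is `∞` if `T` is not Hilbert-Schmidt. -/
def hilbertSchmidtNorm {ι H : Type*} [NormedAddCommGroup H] [InnerProductSpace ℂ H]
    (b : HilbertBasis ι ℂ H) (T : H →L[ℂ] H) : ℝ≥0∞ :=
  (∑' i, ‖T (b i)‖ₑ ^ 2) ^ (1 / 2 : ℝ)

end FourierBessel

end

/-! Up to the unitary `ℱ_α`, the operator `F_Σ E_S` has kernel `χ_Σ(y) χ_S(x) j_α(2πxy)`, so its
squared Hilbert-Schmidt norm is the integral of `|j_α(2πxy)|²` over `S × Σ` against `μ_α ⊗ μ_α`. The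
decay bound gives `|j_α(2πxy)|² ≤ κ² (2πxy)^(-2α-1)`; these powers of `x` and `y` cancel the two
densities exactly and leave `2π κ² |S||Σ|`. In
`sum_enorm_projE_fourierBessel_sq_le_of_measure_lt_top` the kernel is treated one `y` at a time, by
Bessel's inequality for an orthonormal family. Once the operator norm is below 1, a function cannot
be concentrated on `S` with its transform on `Σ`, which `norm_le_of_norm_projF_projE_le` makes
quantitative.

Two analytic facts lie underneath. The decay of `j_α` comes from an energy estimate for Bessel's
equation (`exists_bound_rpow_mul_besselj`). Plancherel's theorem (`isFourierBessel_gaussUnitary`)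
ensures that `fourierBessel` is not its default value: the transform sends `exp(-πax²)` to `a^(-α-1)
exp(-πy²/a)`, which preserves the inner products of Gaussians; Gaussians span a dense subspace, so
this extends to a unitary, and Fubini identifies it with the integral on `L¹ ∩ L²`. -/

noncomputable section

namespace FourierBessel

/-! ### The power series of `j_α`: derivative and recurrence -/

/-- The coefficients of the entire function `besselSeries α`. -/
def besselCoeff (α : ℝ) (n : ℕ) : ℝ :=
  (-1 : ℝ) ^ n / ((n.factorial : ℝ) * Real.Gamma ((n : ℝ) + α + 1))

/-- The entire function `s ↦ ∑ (-1)^n / (n! Γ(n+α+1)) s^n`, so that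
`besselj α x = 2^{-α} besselSeries α ((x/2)^2)`. -/
def besselSeries (α s : ℝ) : ℝ := ∑' n : ℕ, besselCoeff α n * s ^ n

theorem besselj_eq (α x : ℝ) :
    besselj α x = 1 / (2 : ℝ) ^ α * besselSeries α ((x / 2) ^ 2) := by
  simp only [besselj, besselSeries, besselCoeff, pow_mul]

theorem Gamma_pos_nat_add {α : ℝ} (hα : -1 / 2 < α) (n : ℕ) :
    0 < Real.Gamma ((n : ℝ) + α + 1) :=
  Real.Gamma_pos_of_pos (by have : (0 : ℝ) ≤ n := n.cast_nonneg; linarith)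

theorem Gamma_nat_add_succ {α : ℝ} (hα : -1 / 2 < α) (n : ℕ) :
    Real.Gamma (((n + 1 : ℕ) : ℝ) + α + 1) =
      ((n : ℝ) + α + 1) * Real.Gamma ((n : ℝ) + α + 1) := by
  have : (0 : ℝ) ≤ n := n.cast_nonneg
  rw [← Real.Gamma_add_one (by linarith)]
  congr 1
  push_cast
  ring

/-- Each step of the functional equation multiplies by `n + α + 1 > 1/2`, so it loses at most a
factor 2. -/
theorem Gamma_le_two_pow_mul {α : ℝ} (hα : -1 / 2 < α) (n : ℕ) :
    Real.Gamma (α + 1) ≤ 2 ^ n * Real.Gamma ((n : ℝ) + α + 1) := by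
  induction n with
  | zero => simp
  | succ n ih =>
    have : (0 : ℝ) ≤ n := n.cast_nonneg
    rw [Gamma_nat_add_succ hα, pow_succ]
    have h := mul_pos (pow_pos (two_pos : (0 : ℝ) < 2) n) (Gamma_pos_nat_add hα n)
    nlinarith

theorem abs_besselCoeff_le {α : ℝ} (hα : -1 / 2 < α) (n : ℕ) :
    |besselCoeff α n| ≤ (Real.Gamma (α + 1))⁻¹ * (2 ^ n / n.factorial) := by
  have h0 := Gamma_pos_nat_add hα n
  have h1 : 0 < Real.Gamma (α + 1) := Real.Gamma_pos_of_pos (by linarith)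
  have h2 : (0 : ℝ) < n.factorial := by positivity
  rw [besselCoeff, abs_div, abs_pow, abs_neg, abs_one, one_pow, abs_of_pos (by positivity),
    inv_mul_eq_div, div_div, div_le_div_iff₀ (by positivity) (by positivity)]
  have := Gamma_le_two_pow_mul hα n
  nlinarith

theorem summable_besselCoeff_mul_pow {α : ℝ} (hα : -1 / 2 < α) (s : ℝ) :
    Summable fun n : ℕ => besselCoeff α n * s ^ n := by
  refine .of_norm_bounded
    (((Real.summable_pow_div_factorial (2 * |s|)).mul_left (Real.Gamma (α + 1))⁻¹)) fun n => ?_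
  rw [norm_mul, norm_pow, Real.norm_eq_abs, Real.norm_eq_abs, mul_pow]
  calc _ ≤ (Real.Gamma (α + 1))⁻¹ * (2 ^ n / n.factorial) * |s| ^ n := by
        gcongr; exact abs_besselCoeff_le hα n
    _ = _ := by ring

theorem succ_mul_besselCoeff_succ (α : ℝ) (n : ℕ) :
    ((n : ℝ) + 1) * besselCoeff α (n + 1) = -besselCoeff (α + 1) n := by
  simp only [besselCoeff, Nat.factorial_succ, pow_succ]
  have h : (((n + 1 : ℕ) : ℝ) + α + 1) = (n : ℝ) + (α + 1) + 1 := by push_cast; ring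
  rw [h]
  push_cast
  have : (n : ℝ) + 1 ≠ 0 := by positivity
  rw [mul_assoc ((n : ℝ) + 1), ← mul_div_assoc, mul_div_mul_left _ _ this]
  ring

theorem hasDerivAt_besselSeries {α : ℝ} (hα : -1 / 2 < α) (s : ℝ) :
    HasDerivAt (besselSeries α) (-besselSeries (α + 1) s) s := by
  set R := |s| + 1
  have hR : 0 ≤ R := by positivity
  have hG : 0 < Real.Gamma (α + 1) := Real.Gamma_pos_of_pos (by linarith)
  have hu : Summable fun n : ℕ =>
      (Real.Gamma (α + 1))⁻¹ * (2 ^ n / n.factorial) * (n * R ^ (n - 1)) := by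
    -- The shift disposes of the truncated exponent `n - 1` and leaves an exponential series.
    rw [← summable_nat_add_iff 1]
    refine ((Real.summable_pow_div_factorial (2 * R)).mul_left
      (2 * (Real.Gamma (α + 1))⁻¹)).congr fun n => ?_
    rw [Nat.factorial_succ, Nat.add_sub_cancel, mul_pow, pow_succ]
    push_cast
    field_simp
  have key := hasDerivAt_tsum_of_isPreconnected (y₀ := s) (y := s) hu Metric.isOpen_ball
    (convex_ball (0 : ℝ) R).isPreconnected
    (g := fun n y => besselCoeff α n * y ^ n)
    (g' := fun n y => besselCoeff α n * (n * y ^ (n - 1)))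
    (fun n y _ => (hasDerivAt_pow n y).const_mul _) (fun n y hy => ?_)
    (by simp [R]) (summable_besselCoeff_mul_pow hα s) (by simp [R])
  · convert! key using 1
    have hs : Summable fun n : ℕ => besselCoeff α n * (n * s ^ (n - 1)) := by
      rw [← summable_nat_add_iff 1]
      refine (summable_besselCoeff_mul_pow (by linarith : -1 / 2 < α + 1) s).neg.congr fun n => ?_
      have := succ_mul_besselCoeff_succ α n
      rw [← neg_mul, ← this, Nat.add_sub_cancel]
      push_cast
      ring
    rw [hs.tsum_eq_zero_add, besselSeries, ← tsum_neg]
    simp only [CharP.cast_eq_zero, zero_mul, mul_zero, zero_add]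
    refine tsum_congr fun n => ?_
    have := succ_mul_besselCoeff_succ α n
    rw [← neg_mul, ← this, Nat.add_sub_cancel]
    push_cast
    ring
  · rw [mem_ball_zero_iff, Real.norm_eq_abs] at hy
    rw [norm_mul, norm_mul, norm_pow, Real.norm_eq_abs, Real.norm_eq_abs, Real.norm_eq_abs,
      Nat.abs_cast]
    gcongr
    exact abs_besselCoeff_le hα n

/-- By the functional equation of Gamma the right side has coefficients `-n c_{α+1}(n)`; the term `n
= 0` drops out, and `succ_mul_besselCoeff_succ` turns the rest into the series for `α + 2`. With the
derivative formula this replaces Bessel's differential equation. -/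
theorem besselSeries_recurrence {α : ℝ} (hα : -1 / 2 < α) (s : ℝ) :
    s * besselSeries (α + 1 + 1) s = (α + 1) * besselSeries (α + 1) s - besselSeries α s := by
  have h0 := summable_besselCoeff_mul_pow hα s
  have h1 := summable_besselCoeff_mul_pow (by linarith : -1 / 2 < α + 1) s
  have h2 := summable_besselCoeff_mul_pow (by linarith : -1 / 2 < α + 1 + 1) s
  have e (n : ℕ) : besselCoeff α n = (n + α + 1) * besselCoeff (α + 1) n := by
    have := Gamma_nat_add_succ hα n
    have h : (n : ℝ) + (α + 1) + 1 = ((n + 1 : ℕ) : ℝ) + α + 1 := by push_cast; ring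
    have hp := Gamma_pos_nat_add hα n
    have hn : (0 : ℝ) ≤ n := n.cast_nonneg
    have : (n : ℝ) + α + 1 ≠ 0 := by linarith
    rw [besselCoeff, besselCoeff, h, Gamma_nat_add_succ hα]
    field_simp
  have hd : Summable fun n : ℕ => ((α + 1) * besselCoeff (α + 1) n - besselCoeff α n) * s ^ n :=
    ((h1.mul_left (α + 1)).sub h0).congr fun n => by ring
  have : (α + 1) * besselSeries (α + 1) s - besselSeries α s
      = ∑' n : ℕ, ((α + 1) * besselCoeff (α + 1) n - besselCoeff α n) * s ^ n := by
    rw [besselSeries, besselSeries, ← tsum_mul_left, ← (h1.mul_left (α + 1)).tsum_sub h0]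
    exact tsum_congr fun n => by ring
  rw [this, hd.tsum_eq_zero_add, besselSeries, ← tsum_mul_left, e 0]
  simp only [CharP.cast_eq_zero, zero_add, sub_self, zero_mul]
  refine tsum_congr fun n => ?_
  have := succ_mul_besselCoeff_succ (α + 1) n
  rw [e (n + 1), ← neg_neg (besselCoeff (α + 1 + 1) n), ← this]
  push_cast
  ring

theorem hasDerivAt_besselj {α : ℝ} (hα : -1 / 2 < α) (x : ℝ) :
    HasDerivAt (besselj α) (-x * besselj (α + 1) x) x := by
  have h : HasDerivAt (fun x : ℝ => (x / 2) ^ 2) (x / 2) x := by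
    convert! ((hasDerivAt_id x).div_const 2).pow 2 using 1
    simp
    ring
  have h2 := ((hasDerivAt_besselSeries hα ((x / 2) ^ 2)).comp x h).const_mul (1 / (2 : ℝ) ^ α)
  rw [show besselj α = fun x => _ from funext (besselj_eq α)]
  convert! h2 using 1
  rw [besselj_eq, Real.rpow_add_one two_ne_zero]
  field_simp

theorem continuous_besselj {α : ℝ} (hα : -1 / 2 < α) : Continuous (besselj α) :=
  continuous_iff_continuousAt.2 fun x => (hasDerivAt_besselj hα x).continuousAt

theorem besselj_recurrence {α : ℝ} (hα : -1 / 2 < α) (x : ℝ) :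
    x ^ 2 * besselj (α + 1 + 1) x = 2 * (α + 1) * besselj (α + 1) x - besselj α x := by
  have := besselSeries_recurrence hα ((x / 2) ^ 2)
  rw [div_pow] at this
  have h2 : (2 : ℝ) ^ α ≠ 0 := by positivity
  rw [besselj_eq, besselj_eq, besselj_eq, Real.rpow_add_one two_ne_zero,
    Real.rpow_add_one two_ne_zero]
  field_simp
  linear_combination 4 * this

/-! ### Decay and boundedness of `j_α` -/

/-- `u(t) = t^{α+1/2} j_α(t)` is bounded on `[1, ∞)`: with `v` minus its derivative, the
equation `dv/dt = (1 + c / t²) u` shows that `(u² + v²) exp (|c| / t)` is nonincreasing. -/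
theorem exists_bound_rpow_mul_besselj {α : ℝ} (hα : -1 / 2 < α) :
    ∃ C : ℝ, ∀ t : ℝ, 1 ≤ t → |t ^ (α + 1 / 2) * besselj α t| ≤ C := by
  set b : ℝ := α + 1 / 2 with hb
  -- Here `c = 1/4 - α²`, and Bessel's equation reads `u'' = -(1 + c/t²) u`.
  set c : ℝ := b - b ^ 2
  set u : ℝ → ℝ := fun t => t ^ b * besselj α t with hu
  set v : ℝ → ℝ := fun t => t ^ b * (t * besselj (α + 1) t - b / t * besselj α t) with hv
  have hpow {t : ℝ} (ht : 0 < t) : HasDerivAt (fun t : ℝ => t ^ b) (b / t * t ^ b) t := by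
    convert! Real.hasDerivAt_rpow_const (p := b) (Or.inl ht.ne') using 1
    rw [Real.rpow_sub_one ht.ne']
    field_simp
  have hu' {t : ℝ} (ht : 0 < t) : HasDerivAt u (-v t) t := by
    convert! (hpow ht).mul (hasDerivAt_besselj hα t) using 1
    simp only [hv]
    ring
  have hv' {t : ℝ} (ht : 0 < t) : HasDerivAt v ((1 + c / t ^ 2) * u t) t := by
    have h1 := (hasDerivAt_id t).mul (hasDerivAt_besselj (by linarith : -1 / 2 < α + 1) t)
    have h2 := ((hasDerivAt_inv ht.ne').const_mul b).mul (hasDerivAt_besselj hα t)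
    convert! (hpow ht).mul (h1.sub h2) using 1
    have h3 := besselj_recurrence hα t
    have h4 : besselj α t = 2 * (α + 1) * besselj (α + 1) t - t ^ 2 * besselj (α + 1 + 1) t := by
      linarith
    simp only [hu, c, id, Pi.sub_apply, Pi.mul_apply, h4]
    rw [show α = b - 1 / 2 by rw [hb]; ring]
    field_simp
    ring
  set W : ℝ → ℝ := fun t => (u t ^ 2 + v t ^ 2) * Real.exp (|c| / t) with hW
  have hW' {t : ℝ} (ht : 0 < t) : HasDerivAt W
      ((2 * c * u t * v t - |c| * (u t ^ 2 + v t ^ 2)) / t ^ 2 * Real.exp (|c| / t)) t := by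
    convert! (((hu' ht).pow 2).add ((hv' ht).pow 2)).mul
      ((hasDerivAt_inv ht.ne').const_mul |c|).exp using 1
    simp only [Pi.add_apply, Pi.pow_apply, div_eq_mul_inv]
    field_simp
    ring
  have hanti : AntitoneOn W (Set.Ici 1) := by
    refine antitoneOn_of_deriv_nonpos (convex_Ici 1)
      (fun t ht => (hW' (zero_lt_one.trans_le ht)).continuousAt.continuousWithinAt)
      (fun t ht => ?_) (fun t ht => ?_)
    · rw [interior_Ici] at ht
      exact (hW' (zero_lt_one.trans ht)).differentiableAt.differentiableWithinAt
    · rw [interior_Ici] at ht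
      rw [(hW' (zero_lt_one.trans ht)).deriv]
      refine mul_nonpos_of_nonpos_of_nonneg (div_nonpos_of_nonpos_of_nonneg ?_ (by positivity))
        (Real.exp_pos _).le
      -- The numerator is `-|c| (u - v)²` or `-|c| (u + v)²`, according to the sign of `c`.
      rcases abs_cases c with ⟨h, h'⟩ | ⟨h, h'⟩ <;> rw [h]
      · nlinarith [mul_nonneg h' (sq_nonneg (u t - v t))]
      · nlinarith [mul_nonneg (neg_nonneg.2 h'.le) (sq_nonneg (u t + v t))]
  refine ⟨√(W 1), fun t ht => Real.abs_le_sqrt ?_⟩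
  have h1 : W t ≤ W 1 := hanti (Set.mem_Ici.2 le_rfl) ht ht
  have h2 : 1 ≤ Real.exp (|c| / t) := Real.one_le_exp (by positivity)
  refine le_trans ?_ h1
  change u t ^ 2 ≤ _
  simp only [hW]
  nlinarith [sq_nonneg (u t), sq_nonneg (v t)]

theorem exists_bound_besselj_Icc {α : ℝ} (hα : -1 / 2 < α) :
    ∃ C : ℝ, 0 ≤ C ∧ ∀ t ∈ Set.Icc (0 : ℝ) 1, |besselj α t| ≤ C := by
  obtain ⟨C, hC⟩ := isCompact_Icc.exists_bound_of_continuousOn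
    (continuous_besselj hα).continuousOn (s := Set.Icc (0 : ℝ) 1)
  exact ⟨C, (norm_nonneg _).trans (hC 0 (by simp)), hC⟩

theorem exists_besselBound {α : ℝ} (hα : -1 / 2 < α) : ∃ κ : ℝ, BesselBound α κ := by
  obtain ⟨C, hC⟩ := exists_bound_rpow_mul_besselj hα
  obtain ⟨D, hD0, hD⟩ := exists_bound_besselj_Icc hα
  refine ⟨max C D, fun t ht => ?_⟩
  rcases le_total t 1 with h | h
  · have : 1 ≤ t ^ (-α - 1 / 2) :=
      Real.one_le_rpow_of_pos_of_le_one_of_nonpos ht h (by linarith)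
    calc _ ≤ D := hD t ⟨ht.le, h⟩
      _ ≤ D * t ^ (-α - 1 / 2) := le_mul_of_one_le_right hD0 this
      _ ≤ _ := by gcongr; exact le_max_right _ _
  · have hp : 0 < t ^ (α + 1 / 2) := Real.rpow_pos_of_pos ht _
    rw [show -α - 1 / 2 = -(α + 1 / 2) by ring, Real.rpow_neg ht.le, ← div_eq_mul_inv,
      le_div_iff₀ hp, mul_comm]
    have := hC t h
    rw [abs_mul, abs_of_pos hp] at this
    exact this.trans (le_max_left _ _)

/-- Evenness reduces to `t ≥ 0`, and for `t ≥ 1` the decay exponent is negative. A global bound on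
the kernel is what Fubini needs later. -/
theorem exists_bound_besselj {α : ℝ} (hα : -1 / 2 < α) :
    ∃ C : ℝ, ∀ t : ℝ, |besselj α t| ≤ C := by
  obtain ⟨κ, hκ⟩ := exists_besselBound hα
  obtain ⟨D, hD0, hD⟩ := exists_bound_besselj_Icc hα
  have hκ0 : 0 ≤ κ := by simpa using (abs_nonneg _).trans (hκ 1 one_pos)
  refine ⟨max κ D, fun t => ?_⟩
  rw [show besselj α t = besselj α |t| by
    rw [besselj_eq, besselj_eq, div_pow, div_pow, sq_abs]]
  rcases le_total |t| 1 with h | h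
  · exact (hD |t| ⟨abs_nonneg t, h⟩).trans (le_max_right _ _)
  · refine (hκ |t| (by linarith)).trans (le_trans ?_ (le_max_left _ _))
    exact mul_le_of_le_one_right hκ0 (Real.rpow_le_one_of_one_le_of_nonpos h (by linarith))

/-! ### Gaussian moments determine a function -/

open BoundedContinuousFunction in
/-- An integrable function is determined by its moments against an injective bounded continuous
function. -/
theorem ae_eq_zero_of_integral_mul_pow_eq_zero {μ : Measure ℝ} (T : ℝ →ᵇ ℝ)
    (hT : Function.Injective T) {h : ℝ → ℝ} (hh : Integrable h μ)
    (h0 : ∀ n : ℕ, ∫ x, h x * T x ^ n ∂μ = 0) : h =ᵐ[μ] 0 := by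
  have hbdd (g : ℝ →ᵇ ℝ) : Integrable (fun x => h x * g x) μ := by
    simp_rw [mul_comm (h _)]
    exact hh.bdd_mul (c := ‖g‖) g.continuous.aestronglyMeasurable (.of_forall g.norm_coe_le_norm)
  have hstar (a : ℝ →ᵇ ℝ) : star a = a := ext fun x => star_trivial (a x)
  -- `A` consists of the polynomials in `T`. It separates points because `T` is injective, so it
  -- determines finite measures; this is applied to the positive and negative parts of `h`.
  let A : StarSubalgebra ℝ (ℝ →ᵇ ℝ) :=
    { Algebra.adjoin ℝ {T} with star_mem' := fun {a} ha => by rwa [hstar] }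
  have hTA : T ∈ A := Algebra.self_mem_adjoin_singleton ℝ T
  have hzero (g : ℝ →ᵇ ℝ) (hg : g ∈ A) : ∫ x, h x * g x ∂μ = 0 := by
    have hg' : g ∈ Algebra.adjoin ℝ {T} := hg
    rw [Algebra.adjoin_singleton_eq_range_aeval] at hg'
    obtain ⟨p, rfl⟩ := hg'
    induction p using Polynomial.induction_on' with
    | add p q hp hq =>
      have hm (p : Polynomial ℝ) : Polynomial.aeval T p ∈ A := by
        change _ ∈ Algebra.adjoin ℝ {T}
        rw [Algebra.adjoin_singleton_eq_range_aeval]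
        exact ⟨p, rfl⟩
      have hp := hp (hm p)
      have hq := hq (hm q)
      simp only [AlgHom.toRingHom_eq_coe, RingHom.coe_coe, map_add, coe_add, Pi.add_apply,
        mul_add] at hp hq ⊢
      rw [integral_add (hbdd _) (hbdd _), hp, hq, add_zero]
    | monomial n a =>
      have : ∀ x, h x * (Polynomial.aeval T (Polynomial.monomial n a)) x
          = a * (h x * T x ^ n) := fun x => by
        simp [Polynomial.aeval_monomial]
        ring
      simp only [AlgHom.toRingHom_eq_coe, RingHom.coe_coe, this]
      rw [integral_const_mul, h0, mul_zero]
  have : IsFiniteMeasure (μ.withDensity fun x => ENNReal.ofReal (h x)) :=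
    isFiniteMeasure_withDensity_ofReal hh.2
  have : IsFiniteMeasure (μ.withDensity fun x => ENNReal.ofReal (-h x)) :=
    isFiniteMeasure_withDensity_ofReal hh.neg.2
  have hm : AEMeasurable (fun x => ENNReal.ofReal (h x)) μ := hh.1.aemeasurable.ennreal_ofReal
  have hm' : AEMeasurable (fun x => ENNReal.ofReal (-h x)) μ :=
    hh.neg.1.aemeasurable.ennreal_ofReal
  have key : (μ.withDensity fun x => ENNReal.ofReal (h x)) =
      μ.withDensity fun x => ENNReal.ofReal (-h x) := by
    refine ext_of_forall_mem_subalgebra_integral_eq_of_pseudoEMetric_complete_countable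
      (A := A) ?_ fun g hg => ?_
    · intro x y hxy
      exact ⟨T, ⟨toContinuousMapStarₐ ℝ T, ⟨T, hTA, rfl⟩, rfl⟩, fun e => hxy (hT e)⟩
    · rw [integral_withDensity_eq_integral_toReal_smul₀ hm (by simp),
        integral_withDensity_eq_integral_toReal_smul₀ hm' (by simp), ← sub_eq_zero]
      have hp : Integrable (fun x => max (h x) 0 * g x) μ := by
        simp_rw [mul_comm _ (g _)]
        exact hh.pos_part.bdd_mul (c := ‖g‖) g.continuous.aestronglyMeasurable
          (.of_forall g.norm_coe_le_norm)
      have hn : Integrable (fun x => max (-h x) 0 * g x) μ := by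
        simp_rw [mul_comm _ (g _)]
        exact hh.neg_part.bdd_mul (c := ‖g‖) g.continuous.aestronglyMeasurable
          (.of_forall g.norm_coe_le_norm)
      simp only [ENNReal.toReal_ofReal', smul_eq_mul]
      rw [← integral_sub hp hn]
      refine Eq.trans ?_ (hzero g hg)
      congr 1 with x
      rw [← sub_mul]
      congr 1
      rcases le_total (h x) 0 with h | h
      · rw [max_eq_right h, max_eq_left (by linarith)]; ring
      · rw [max_eq_left h, max_eq_right (by linarith)]; ring
  have hfin : ∫⁻ x, ENNReal.ofReal (h x) ∂μ ≠ ⊤ := by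
    have := measure_ne_top (μ.withDensity fun x => ENNReal.ofReal (h x)) Set.univ
    rwa [withDensity_apply _ MeasurableSet.univ, setLIntegral_univ] at this
  filter_upwards [(withDensity_eq_iff hm hm' hfin).1 key] with x hx
  rcases le_total (h x) 0 with hsign | hsign
  · rw [ENNReal.ofReal_of_nonpos hsign, eq_comm, ENNReal.ofReal_eq_zero] at hx
    exact le_antisymm hsign (neg_nonpos.1 hx)
  · rw [ENNReal.ofReal_of_nonpos (by linarith : -h x ≤ 0), ENNReal.ofReal_eq_zero] at hx
    exact le_antisymm hx hsign

/-- The Gaussian `x ↦ exp (-π a x²)`. -/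
def gauss (a x : ℝ) : ℝ := Real.exp (-(Real.pi * a) * x ^ 2)

theorem continuous_gauss (a : ℝ) : Continuous (gauss a) := by
  unfold gauss
  fun_prop

theorem gauss_pos (a x : ℝ) : 0 < gauss a x := Real.exp_pos _

theorem gauss_mul (a b x : ℝ) : gauss a x * gauss b x = gauss (a + b) x := by
  rw [gauss, gauss, gauss, ← Real.exp_add]
  ring_nf

/-- A bounded continuous injective function on `ℝ` that agrees with `gauss 1` on `[0, ∞)`. -/
theorem exists_injective_extension_gauss :
    ∃ T : BoundedContinuousFunction ℝ ℝ, Function.Injective T ∧ ∀ x, 0 ≤ x → T x = gauss 1 x := by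
  -- On the negative axis the values exceed 1, so they cannot meet those in `(0, 1]` taken on `[0,
  -- ∞)`.
  let f : ℝ → ℝ := fun x => if 0 ≤ x then gauss 1 x else 2 - gauss 1 x
  have hle (x : ℝ) : gauss 1 x ≤ 1 := by
    rw [gauss, Real.exp_le_one_iff]
    have := mul_nonneg Real.pi_pos.le (sq_nonneg x)
    nlinarith
  have hlt {x : ℝ} (hx : x < 0) : gauss 1 x < 1 := by
    rw [gauss, Real.exp_lt_one_iff]
    have := mul_pos Real.pi_pos (sq_pos_of_neg hx)
    nlinarith
  have hcont : Continuous f := by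
    refine Continuous.if_le (continuous_gauss 1) (continuous_const.sub (continuous_gauss 1))
      continuous_const continuous_id fun x hx => ?_
    rw [← id_def x, ← hx]
    norm_num [gauss]
  have hsq {x y : ℝ} (h : gauss 1 x = gauss 1 y) : x ^ 2 = y ^ 2 := by
    have := Real.exp_injective h
    have hp := Real.pi_pos
    have h2 : Real.pi * (x ^ 2 - y ^ 2) = 0 := by linarith
    rcases mul_eq_zero.1 h2 with h | h <;> linarith
  refine ⟨.ofNormedAddCommGroup f hcont 2 fun x => ?_, fun x y hxy => ?_, fun x hx => ?_⟩
  · have := hle x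
    have := gauss_pos 1 x
    simp only [f, Real.norm_eq_abs]
    split_ifs <;> rw [abs_le] <;> constructor <;> linarith
  · simp only [BoundedContinuousFunction.coe_ofNormedAddCommGroup, f] at hxy
    split_ifs at hxy with h1 h2 h2
    · exact (sq_eq_sq₀ h1 h2).1 (hsq hxy)
    · have := hle x
      have := hlt (not_le.1 h2)
      linarith
    · have := hle y
      have := hlt (not_le.1 h1)
      linarith
    · have := (sq_eq_sq₀ (by linarith : 0 ≤ -x) (by linarith : 0 ≤ -y)).1
        (by rw [neg_sq, neg_sq]; exact hsq (by linarith))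
      linarith
  · simp [f, hx]

theorem gauss_one_pow (n : ℕ) (x : ℝ) : gauss 1 x ^ n = gauss n x := by
  rw [gauss, gauss, ← Real.exp_nat_mul]
  ring_nf

theorem ae_muAlpha_pos (α : ℝ) : ∀ᵐ x ∂(muAlpha α), 0 < x :=
  (withDensity_absolutelyContinuous _ _).ae_le (ae_restrict_mem measurableSet_Ioi)

instance sigmaFinite_muAlpha (α : ℝ) : SigmaFinite (muAlpha α) :=
  SigmaFinite.withDensity_ofReal _

/-- A function is determined by its integrals against the Gaussians `gauss n`, `n ≥ 1`. -/
theorem ae_eq_zero_of_integral_gauss_eq_zero (α : ℝ) {h : ℝ → ℂ}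
    (hh : Integrable (fun x => h x * (gauss 1 x : ℂ)) (muAlpha α))
    (h0 : ∀ n : ℕ, ∫ x, h x * (gauss (n + 1) x : ℂ) ∂(muAlpha α) = 0) :
    h =ᵐ[muAlpha α] 0 := by
  obtain ⟨T, hT, hTg⟩ := exists_injective_extension_gauss
  have hinteg (n : ℕ) : Integrable (fun x => h x * (gauss (n + 1) x : ℂ)) (muAlpha α) := by
    have : Integrable (fun x => (gauss n x : ℂ) * (h x * (gauss 1 x : ℂ))) (muAlpha α) := by
      refine hh.bdd_mul (c := 1) (Complex.continuous_ofReal.comp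
        (continuous_gauss _)).aestronglyMeasurable (.of_forall fun x => ?_)
      rw [Complex.norm_real, Real.norm_of_nonneg (gauss_pos _ _).le, gauss, Real.exp_le_one_iff]
      have : 0 ≤ Real.pi * n * x ^ 2 := by positivity
      linarith
    refine this.congr (.of_forall fun x => ?_)
    simp only [← gauss_mul]
    push_cast
    ring
  -- One Gaussian serves as integrable weight; the `n`-th power of `T` then supplies the other `n`,
  -- on `(0, ∞)`, where `μ_α` lives.
  have hpow (n : ℕ) : (fun x => h x * (gauss 1 x : ℂ) * ((T x ^ n : ℝ) : ℂ)) =ᵐ[muAlpha α]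
      fun x => h x * (gauss (n + 1) x : ℂ) := by
    filter_upwards [ae_muAlpha_pos α] with x hx
    rw [hTg x hx.le, gauss_one_pow, mul_assoc, ← Complex.ofReal_mul, gauss_mul, add_comm]
  have hre : (fun x => (h x * (gauss 1 x : ℂ)).re) =ᵐ[muAlpha α] 0 := by
    refine ae_eq_zero_of_integral_mul_pow_eq_zero T hT hh.re fun n => ?_
    have := congrArg Complex.re ((integral_congr_ae (hpow n)).trans (h0 n))
    rw [← RCLike.re_eq_complex_re, ← integral_re ((hinteg n).congr (hpow n).symm)] at this
    simpa only [RCLike.re_eq_complex_re, Complex.re_mul_ofReal, Complex.zero_re] using this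
  have him : (fun x => (h x * (gauss 1 x : ℂ)).im) =ᵐ[muAlpha α] 0 := by
    refine ae_eq_zero_of_integral_mul_pow_eq_zero T hT hh.im fun n => ?_
    have := congrArg Complex.im ((integral_congr_ae (hpow n)).trans (h0 n))
    rw [← RCLike.im_eq_complex_im, ← integral_im ((hinteg n).congr (hpow n).symm)] at this
    simpa only [RCLike.im_eq_complex_im, Complex.im_mul_ofReal, Complex.zero_im] using this
  filter_upwards [hre, him] with x h1 h2
  have : h x * (gauss 1 x : ℂ) = 0 := Complex.ext h1 h2
  exact (mul_eq_zero.1 this).resolve_right (by exact_mod_cast (gauss_pos 1 x).ne')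

/-! ### Gaussian integrals and the transform of a Gaussian -/

theorem measurable_muAlpha_density (α : ℝ) : Measurable fun x : ℝ =>
    ENNReal.ofReal ((2 * Real.pi) ^ (α + 1) * x ^ (2 * α + 1)) := by
  fun_prop

theorem integral_muAlpha {E : Type*} [NormedAddCommGroup E] [NormedSpace ℝ E] (α : ℝ)
    (f : ℝ → E) : ∫ x, f x ∂(muAlpha α) =
      ∫ x in Set.Ioi 0, ((2 * Real.pi) ^ (α + 1) * x ^ (2 * α + 1)) • f x := by
  rw [muAlpha, integral_withDensity_eq_integral_toReal_smul (measurable_muAlpha_density α)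
    (by simp)]
  refine setIntegral_congr_fun measurableSet_Ioi fun x hx => ?_
  have hx : (0 : ℝ) < x := hx
  rw [ENNReal.toReal_ofReal (by positivity)]

theorem integrable_muAlpha_iff {E : Type*} [NormedAddCommGroup E] [NormedSpace ℝ E] (α : ℝ)
    (f : ℝ → E) : Integrable f (muAlpha α) ↔
      IntegrableOn (fun x => ((2 * Real.pi) ^ (α + 1) * x ^ (2 * α + 1)) • f x) (Set.Ioi 0) := by
  rw [muAlpha, integrable_withDensity_iff_integrable_smul' (measurable_muAlpha_density α)
    (by simp)]
  refine integrableOn_congr_fun (fun x hx => ?_) measurableSet_Ioi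
  have hx : (0 : ℝ) < x := hx
  rw [ENNReal.toReal_ofReal (by positivity)]

theorem muAlpha_density_smul_pow_mul_gauss (α a : ℝ) (n : ℕ) {x : ℝ}
    (hx : x ∈ Set.Ioi (0 : ℝ)) :
    ((2 * Real.pi) ^ (α + 1) * x ^ (2 * α + 1)) • (x ^ (2 * n) * gauss a x) =
      (2 * Real.pi) ^ (α + 1) *
        (x ^ (2 * (n + α + 1) - 1) * Real.exp (-(Real.pi * a) * x ^ 2)) := by
  rw [show 2 * ((n : ℝ) + α + 1) - 1 = 2 * α + 1 + (2 * n : ℕ) by push_cast; ring,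
    Real.rpow_add hx (2 * α + 1), Real.rpow_natCast, gauss, smul_eq_mul]
  ring

theorem integrable_pow_mul_gauss {α : ℝ} (hα : -1 / 2 < α) (n : ℕ) {a : ℝ} (ha : 0 < a) :
    Integrable (fun x => x ^ (2 * n) * gauss a x) (muAlpha α) := by
  have hn : (0 : ℝ) ≤ n := n.cast_nonneg
  rw [integrable_muAlpha_iff, integrableOn_congr_fun
    (fun x hx => muAlpha_density_smul_pow_mul_gauss α a n hx) measurableSet_Ioi]
  exact (integrableOn_rpow_mul_exp_neg_mul_sq (mul_pos Real.pi_pos ha) (by linarith)).const_mul _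

theorem integral_pow_mul_gauss {α : ℝ} (hα : -1 / 2 < α) (n : ℕ) {a : ℝ} (ha : 0 < a) :
    ∫ x, x ^ (2 * n) * gauss a x ∂(muAlpha α) =
      2 ^ α * Real.Gamma (n + α + 1) * a ^ (-(α + 1)) / (Real.pi * a) ^ n := by
  have hn : (0 : ℝ) ≤ n := n.cast_nonneg
  have hπ := Real.pi_pos
  rw [integral_muAlpha, setIntegral_congr_fun measurableSet_Ioi
    (fun x hx => muAlpha_density_smul_pow_mul_gauss α a n hx), integral_const_mul]
  have h := integral_rpow_mul_exp_neg_mul_rpow (p := 2) (q := 2 * (n + α + 1) - 1) two_pos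
    (by linarith) (mul_pos hπ ha)
  simp only [Real.rpow_two] at h
  rw [h, show -(2 * ((n : ℝ) + α + 1) - 1 + 1) / 2 = -(α + 1) - n by ring,
    show (2 * ((n : ℝ) + α + 1) - 1 + 1) / 2 = n + α + 1 by ring,
    Real.rpow_sub (by positivity), Real.rpow_natCast, Real.mul_rpow two_pos.le hπ.le,
    Real.mul_rpow hπ.le ha.le, Real.rpow_neg hπ.le, Real.rpow_add_one two_ne_zero]
  field_simp

theorem integrable_gauss {α : ℝ} (hα : -1 / 2 < α) {a : ℝ} (ha : 0 < a) :
    Integrable (gauss a) (muAlpha α) := by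
  simpa using integrable_pow_mul_gauss hα 0 ha

theorem integral_gauss {α : ℝ} (hα : -1 / 2 < α) {a : ℝ} (ha : 0 < a) :
    ∫ x, gauss a x ∂(muAlpha α) = 2 ^ α * Real.Gamma (α + 1) * a ^ (-(α + 1)) := by
  simpa using integral_pow_mul_gauss hα 0 ha

/-- Integrating the series of `j_α` termwise, the Gamma factor of each Gaussian moment cancels the
one in the coefficient, and an exponential series remains. Its absolute convergence also justifies
the interchange. -/
theorem integral_gauss_mul_besselj {α : ℝ} (hα : -1 / 2 < α) {a : ℝ} (ha : 0 < a) (y : ℝ) :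
    ∫ x, gauss a x * besselj α (2 * Real.pi * x * y) ∂(muAlpha α) =
      a ^ (-(α + 1)) * gauss a⁻¹ y := by
  have hπ := Real.pi_pos
  set C : ℕ → ℝ := fun n => 1 / (2 : ℝ) ^ α * besselCoeff α n * (Real.pi * y) ^ (2 * n)
  have hterm (n : ℕ) : C n * ∫ x, x ^ (2 * n) * gauss a x ∂(muAlpha α) =
      a ^ (-(α + 1)) * ((-(Real.pi * a⁻¹) * y ^ 2) ^ n / n.factorial) := by
    have := Gamma_pos_nat_add hα n
    rw [integral_pow_mul_gauss hα n ha]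
    simp only [C, besselCoeff, pow_mul, mul_pow, neg_mul, neg_pow (Real.pi * a⁻¹ * y ^ 2), inv_pow]
    field_simp
    ring
  have habs (n : ℕ) : ∫ x, ‖C n * (x ^ (2 * n) * gauss a x)‖ ∂(muAlpha α) =
      |a ^ (-(α + 1)) * ((-(Real.pi * a⁻¹) * y ^ 2) ^ n / n.factorial)| := by
    have hpos (x : ℝ) : 0 ≤ x ^ (2 * n) * gauss a x :=
      mul_nonneg (pow_mul x 2 n ▸ by positivity) (gauss_pos a x).le
    rw [← hterm, abs_mul, abs_of_nonneg (integral_nonneg hpos), ← integral_const_mul]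
    congr 1 with x
    rw [norm_mul, Real.norm_eq_abs, Real.norm_of_nonneg (hpos x)]
  have hsum := (Real.summable_pow_div_factorial (-(Real.pi * a⁻¹) * y ^ 2)).mul_left
    (a ^ (-(α + 1)))
  have h1 := hasSum_integral_of_summable_integral_norm
    (fun n => (integrable_pow_mul_gauss hα n ha).const_mul (C n))
    (by simp only [habs]; exact hsum.abs)
  have h2 (x : ℝ) : gauss a x * besselj α (2 * Real.pi * x * y) =
      ∑' n, C n * (x ^ (2 * n) * gauss a x) := by
    rw [besselj, ← tsum_mul_left, ← tsum_mul_left]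
    refine tsum_congr fun n => ?_
    simp only [C, besselCoeff]
    rw [show 2 * Real.pi * x * y / 2 = Real.pi * y * x by ring, mul_pow _ x]
    ring
  simp only [h2]
  rw [← h1.tsum_eq]
  simp only [integral_const_mul, hterm]
  rw [tsum_mul_left, gauss, Real.exp_eq_exp_ℝ, NormedSpace.exp_eq_tsum_div]

theorem fourierBesselIntegral_gauss {α : ℝ} (hα : -1 / 2 < α) {a : ℝ} (ha : 0 < a) (y : ℝ) :
    fourierBesselIntegral α (fun x => (gauss a x : ℂ)) y =
      ((a ^ (-(α + 1)) * gauss a⁻¹ y : ℝ) : ℂ) := by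
  rw [← integral_gauss_mul_besselj hα ha, ← integral_complex_ofReal]
  simp [fourierBesselIntegral]

theorem memLp_gauss {α : ℝ} (hα : -1 / 2 < α) {a : ℝ} (ha : 0 < a) :
    MemLp (fun x => (gauss a x : ℂ)) 2 (muAlpha α) := by
  refine (memLp_two_iff_integrable_sq_norm
    (Complex.continuous_ofReal.comp (continuous_gauss a)).aestronglyMeasurable).2 ?_
  refine (integrable_gauss hα (add_pos ha ha)).congr (.of_forall fun x => ?_)
  simp only [Function.comp_apply]
  rw [Complex.norm_real, Real.norm_eq_abs, sq_abs, sq, gauss_mul]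

/-! ### Plancherel's theorem through Gaussians -/

/-- The class of the Gaussian `gauss a` in `L²_α`. -/
def gaussLp {α : ℝ} (hα : -1 / 2 < α) (a : Set.Ioi (0 : ℝ)) : L2 α :=
  (memLp_gauss hα a.2).toLp _

theorem coeFn_gaussLp {α : ℝ} (hα : -1 / 2 < α) (a : Set.Ioi (0 : ℝ)) :
    (gaussLp hα a : ℝ → ℂ) =ᵐ[muAlpha α] fun x => (gauss a x : ℂ) :=
  MemLp.coeFn_toLp _

theorem inner_gaussLp {α : ℝ} (hα : -1 / 2 < α) (a : Set.Ioi (0 : ℝ)) (f : L2 α) :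
    inner ℂ (gaussLp hα a) f = ∫ x, f x * (gauss a x : ℂ) ∂(muAlpha α) := by
  rw [L2.inner_def]
  refine integral_congr_ae ?_
  filter_upwards [coeFn_gaussLp hα a] with x hx
  rw [hx, RCLike.inner_apply, Complex.conj_ofReal]

theorem inner_gaussLp_gaussLp {α : ℝ} (hα : -1 / 2 < α) (a b : Set.Ioi (0 : ℝ)) :
    inner ℂ (gaussLp hα a) (gaussLp hα b) =
      ((2 ^ α * Real.Gamma (α + 1) * (a + b : ℝ) ^ (-(α + 1)) : ℝ) : ℂ) := by
  rw [inner_gaussLp, ← integral_gauss hα (add_pos a.2 b.2), ← integral_complex_ofReal]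
  refine integral_congr_ae ?_
  filter_upwards [coeFn_gaussLp hα b] with x hx
  rw [hx, ← Complex.ofReal_mul, mul_comm, gauss_mul]

theorem integrable_mul_gauss {α : ℝ} (hα : -1 / 2 < α) {a : ℝ} (ha : 0 < a) (f : L2 α) :
    Integrable (fun x => f x * (gauss a x : ℂ)) (muAlpha α) :=
  (Lp.memLp f).integrable_mul (memLp_gauss hα ha)

theorem eq_zero_of_inner_gaussLp_eq_zero {α : ℝ} (hα : -1 / 2 < α) {f : L2 α}
    (h : ∀ a, inner ℂ (gaussLp hα a) f = 0) : f = 0 := by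
  rw [Lp.eq_zero_iff_ae_eq_zero]
  refine ae_eq_zero_of_integral_gauss_eq_zero α (integrable_mul_gauss hα one_pos f) fun n => ?_
  exact (inner_gaussLp hα ⟨(n : ℝ) + 1, Set.mem_Ioi.2 (Nat.cast_add_one_pos n)⟩ f).symm.trans (h _)

theorem denseRange_linearCombination {ι E : Type*} [NormedAddCommGroup E]
    [InnerProductSpace ℂ E] [CompleteSpace E] {v : ι → E}
    (h : ∀ f, (∀ i, inner ℂ (v i) f = 0) → f = 0) :
    DenseRange (Finsupp.linearCombination ℂ v) := by
  have : Dense ((LinearMap.range (Finsupp.linearCombination ℂ v) : Submodule ℂ E) : Set E) := by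
    rw [Submodule.dense_iff_topologicalClosure_eq_top, Submodule.topologicalClosure_eq_top_iff,
      Finsupp.range_linearCombination, Submodule.eq_bot_iff]
    intro f hf
    exact h f fun i => (Submodule.mem_orthogonal _ _).1 hf _
      (Submodule.subset_span (Set.mem_range_self i))
  rwa [LinearMap.coe_range] at this

theorem norm_linearCombination_eq {ι E F : Type*} [NormedAddCommGroup E]
    [InnerProductSpace ℂ E] [NormedAddCommGroup F] [InnerProductSpace ℂ F] {v : ι → E} {w : ι → F}
    (h : ∀ i j, inner ℂ (v i) (v j) = inner ℂ (w i) (w j)) (x : ι →₀ ℂ) :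
    ‖Finsupp.linearCombination ℂ v x‖ = ‖Finsupp.linearCombination ℂ w x‖ := by
  rw [@norm_eq_sqrt_re_inner ℂ, @norm_eq_sqrt_re_inner ℂ F]
  simp only [Finsupp.linearCombination_apply, Finsupp.sum_inner, Finsupp.inner_sum, h,
    inner_smul_left, inner_smul_right]

/-- The images of the Gaussians under the Fourier-Bessel transform. -/
def gaussImage {α : ℝ} (hα : -1 / 2 < α) (a : Set.Ioi (0 : ℝ)) : L2 α :=
  (((a : ℝ) ^ (-(α + 1)) : ℝ) : ℂ) • gaussLp hα ⟨(a : ℝ)⁻¹, Set.mem_Ioi.2 (inv_pos.2 a.2)⟩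

/-- The Gram matrix depends on `a + b` alone, and `a + b = ab(a⁻¹ + b⁻¹)`; the scalar factors absorb
`ab`. -/
theorem inner_gaussImage {α : ℝ} (hα : -1 / 2 < α) (a b : Set.Ioi (0 : ℝ)) :
    inner ℂ (gaussImage hα a) (gaussImage hα b) = inner ℂ (gaussLp hα a) (gaussLp hα b) := by
  have ha : (0 : ℝ) < a := a.2
  have hb : (0 : ℝ) < b := b.2
  rw [gaussImage, gaussImage, inner_smul_left, inner_smul_right, inner_gaussLp_gaussLp,
    inner_gaussLp_gaussLp, Complex.conj_ofReal, ← Complex.ofReal_mul, ← Complex.ofReal_mul]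
  congr 1
  have : (a + b : ℝ) = a * b * ((a : ℝ)⁻¹ + (b : ℝ)⁻¹) := by
    field_simp
    ring
  rw [this, Real.mul_rpow (by positivity) (by positivity), Real.mul_rpow ha.le hb.le]
  ring

theorem eq_zero_of_inner_gaussImage_eq_zero {α : ℝ} (hα : -1 / 2 < α) {f : L2 α}
    (h : ∀ a, inner ℂ (gaussImage hα a) f = 0) : f = 0 := by
  refine eq_zero_of_inner_gaussLp_eq_zero hα fun a => ?_
  have ha : (0 : ℝ) < a := a.2
  have := h ⟨(a : ℝ)⁻¹, Set.mem_Ioi.2 (inv_pos.2 ha)⟩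
  simp only [gaussImage, inv_inv, inner_smul_left, Complex.conj_ofReal, mul_eq_zero,
    Complex.ofReal_eq_zero] at this
  exact this.resolve_left (by positivity)

/-- The unitary operator of `L²_α` determined by its values on the Gaussians. -/
def gaussUnitary {α : ℝ} (hα : -1 / 2 < α) : L2 α ≃ₗᵢ[ℂ] L2 α :=
  (LinearEquiv.refl ℂ (Set.Ioi (0 : ℝ) →₀ ℂ)).extendOfIsometry
    (Finsupp.linearCombination ℂ (gaussLp hα)) (Finsupp.linearCombination ℂ (gaussImage hα))
    (denseRange_linearCombination fun _ => eq_zero_of_inner_gaussLp_eq_zero hα)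
    (denseRange_linearCombination fun _ => eq_zero_of_inner_gaussImage_eq_zero hα)
    (norm_linearCombination_eq (inner_gaussImage hα))

theorem gaussUnitary_gaussLp {α : ℝ} (hα : -1 / 2 < α) (a : Set.Ioi (0 : ℝ)) :
    gaussUnitary hα (gaussLp hα a) = gaussImage hα a := by
  have := LinearEquiv.extendOfIsometry_eq (LinearEquiv.refl ℂ (Set.Ioi (0 : ℝ) →₀ ℂ))
    (Finsupp.linearCombination ℂ (gaussLp hα)) (Finsupp.linearCombination ℂ (gaussImage hα))
    (denseRange_linearCombination fun _ => eq_zero_of_inner_gaussLp_eq_zero hα)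
    (denseRange_linearCombination fun _ => eq_zero_of_inner_gaussImage_eq_zero hα)
    (norm_linearCombination_eq (inner_gaussImage hα)) (Finsupp.single a 1)
  simpa using! this

theorem gaussUnitary_gaussImage {α : ℝ} (hα : -1 / 2 < α) (a : Set.Ioi (0 : ℝ)) :
    gaussUnitary hα (gaussImage hα a) = gaussLp hα a := by
  have ha : (0 : ℝ) < a := a.2
  rw [gaussImage, map_smul, gaussUnitary_gaussLp, gaussImage, smul_smul, ← Complex.ofReal_mul,
    ← Real.mul_rpow ha.le (inv_pos.2 ha).le]
  simp [mul_inv_cancel₀ ha.ne']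

theorem integrable_mul_gauss_mul_besselj {α : ℝ} (hα : -1 / 2 < α) {a : ℝ} (ha : 0 < a)
    {f : ℝ → ℂ} (hf : Integrable f (muAlpha α)) :
    Integrable (Function.uncurry fun x y : ℝ =>
      (besselj α (2 * Real.pi * x * y) : ℂ) * (f x * (gauss a y : ℂ)))
      ((muAlpha α).prod (muAlpha α)) := by
  obtain ⟨C, hC⟩ := exists_bound_besselj hα
  refine (hf.mul_prod (integrable_gauss hα ha).ofReal).bdd_mul (c := C)
    (Continuous.aestronglyMeasurable ?_) (.of_forall fun p => ?_)
  · have := continuous_besselj hα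
    fun_prop
  · rw [Complex.norm_real]
    exact hC _

/-- Both candidates have the same pairings with Gaussians: unitarity moves the operator onto the
Gaussian on one side, Fubini moves the integral transform onto it on the other. -/
theorem isFourierBessel_gaussUnitary {α : ℝ} (hα : -1 / 2 < α) :
    IsFourierBessel α (gaussUnitary hα) := by
  intro f hf
  have hinteg {a : ℝ} (ha : 0 < a) : Integrable
      (fun y => fourierBesselIntegral α f y * (gauss a y : ℂ)) (muAlpha α) := by
    refine (integrable_mul_gauss_mul_besselj hα ha hf).integral_prod_right.congr
      (.of_forall fun y => ?_)
    simp only [Function.uncurry, fourierBesselIntegral]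
    rw [← integral_mul_const]
    congr 1 with x
    ring
  have hzero : (fun y => gaussUnitary hα f y - fourierBesselIntegral α f y) =ᵐ[muAlpha α] 0 := by
    refine ae_eq_zero_of_integral_gauss_eq_zero α ?_ fun n => ?_
    · simp only [sub_mul]
      exact (integrable_mul_gauss hα one_pos _).sub (hinteg one_pos)
    · have hn : (0 : ℝ) < n + 1 := Nat.cast_add_one_pos n
      let a : Set.Ioi (0 : ℝ) := ⟨n + 1, hn⟩
      simp only [sub_mul]
      rw [integral_sub (integrable_mul_gauss hα hn _) (hinteg hn), sub_eq_zero]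
      calc ∫ y, gaussUnitary hα f y * (gauss (n + 1) y : ℂ) ∂(muAlpha α)
          = inner ℂ (gaussLp hα a) (gaussUnitary hα f) := (inner_gaussLp hα a _).symm
        _ = inner ℂ (gaussImage hα a) f := by
          rw [← gaussUnitary_gaussImage, LinearIsometryEquiv.inner_map_map]
        _ = ∫ x, f x * (((n + 1 : ℝ) ^ (-(α + 1)) * gauss (n + 1 : ℝ)⁻¹ x : ℝ) : ℂ)
              ∂(muAlpha α) := by
          rw [gaussImage, inner_smul_left, inner_gaussLp, Complex.conj_ofReal,
            ← integral_const_mul]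
          congr 1 with x
          push_cast
          ring
        _ = ∫ x, ∫ y, (besselj α (2 * Real.pi * x * y) : ℂ) * (f x * (gauss (n + 1) y : ℂ))
              ∂(muAlpha α) ∂(muAlpha α) := by
          congr 1 with x
          rw [← fourierBesselIntegral_gauss hα hn, fourierBesselIntegral, ← integral_const_mul]
          congr 1 with y
          rw [mul_right_comm _ y x]
          ring
        _ = ∫ y, ∫ x, (besselj α (2 * Real.pi * x * y) : ℂ) * (f x * (gauss (n + 1) y : ℂ))
              ∂(muAlpha α) ∂(muAlpha α) :=
          integral_integral_swap (integrable_mul_gauss_mul_besselj hα hn hf)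
        _ = _ := by
          congr 1 with y
          rw [fourierBesselIntegral, ← integral_mul_const]
          congr 1 with x
          ring
  filter_upwards [hzero] with y hy
  exact sub_eq_zero.1 hy

theorem isFourierBessel_fourierBessel {α : ℝ} (hα : -1 / 2 < α) :
    IsFourierBessel α (fourierBessel α) := by
  have h : ∃ U : L2 α ≃ₗᵢ[ℂ] L2 α, IsFourierBessel α U := ⟨_, isFourierBessel_gaussUnitary hα⟩
  rw [fourierBessel, dif_pos h]
  exact h.choose_spec

/-! ### The projections and truncation of `S` -/

open Filter Topology

theorem coeFn_projE (α : ℝ) {S : Set ℝ} (hS : MeasurableSet S) (f : L2 α) :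
    (projE α S hS f : ℝ → ℂ) =ᵐ[muAlpha α] S.indicator f :=
  coeFn_chiMul S hS f

theorem enorm_sq_eq_lintegral {μ : Measure ℝ} (f : Lp ℂ 2 μ) :
    ‖f‖ₑ ^ 2 = ∫⁻ x, ‖f x‖ₑ ^ 2 ∂μ := by
  rw [Lp.enorm_def, eLpNorm_eq_lintegral_rpow_enorm_toReal two_ne_zero ENNReal.ofNat_ne_top]
  simp only [ENNReal.toReal_ofNat, ENNReal.rpow_two]
  rw [← ENNReal.rpow_two, ← ENNReal.rpow_mul]
  norm_num

theorem enorm_projE_sq (α : ℝ) {S : Set ℝ} (hS : MeasurableSet S) (f : L2 α) :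
    ‖projE α S hS f‖ₑ ^ 2 = ∫⁻ x in S, ‖f x‖ₑ ^ 2 ∂(muAlpha α) := by
  rw [enorm_sq_eq_lintegral, ← lintegral_indicator hS]
  refine lintegral_congr_ae ?_
  filter_upwards [coeFn_projE α hS f] with x hx
  rw [hx]
  by_cases h : x ∈ S <;> simp [h]

theorem norm_projE_le (α : ℝ) {S : Set ℝ} (hS : MeasurableSet S) (f : L2 α) :
    ‖projE α S hS f‖ ≤ ‖f‖ :=
  (norm_chiMul_le S hS f).trans_eq (one_mul _)

theorem norm_projF (α : ℝ) {S : Set ℝ} (hS : MeasurableSet S) (f : L2 α) :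
    ‖projF α S hS f‖ = ‖projE α S hS (fourierBessel α f)‖ := by
  rw [← fourierBessel_projF, LinearIsometryEquiv.norm_map]

theorem norm_projF_le (α : ℝ) {S : Set ℝ} (hS : MeasurableSet S) (f : L2 α) :
    ‖projF α S hS f‖ ≤ ‖f‖ := by
  rw [norm_projF, ← (fourierBessel α).norm_map f]
  exact norm_projE_le α hS _

theorem projE_add_projE_compl (α : ℝ) {S : Set ℝ} (hS : MeasurableSet S) (f : L2 α) :
    projE α S hS f + projE α (Set.Ici 0 \ S) (measurableSet_Ici.diff hS) f = f := by
  refine Lp.ext ?_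
  filter_upwards [Lp.coeFn_add (projE α S hS f)
    (projE α (Set.Ici 0 \ S) (measurableSet_Ici.diff hS) f), coeFn_projE α hS f,
    coeFn_projE α (measurableSet_Ici.diff hS) f, ae_muAlpha_pos α] with x h1 h2 h3 hx
  rw [h1, Pi.add_apply, h2, h3]
  by_cases h : x ∈ S <;> simp [h, hx.le]

theorem projF_add_projF_compl (α : ℝ) {S : Set ℝ} (hS : MeasurableSet S) (f : L2 α) :
    projF α S hS f + projF α (Set.Ici 0 \ S) (measurableSet_Ici.diff hS) f = f := by
  apply (fourierBessel α).injective
  rw [map_add, fourierBessel_projF, fourierBessel_projF, projE_add_projE_compl]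

/-- A set of finite Lebesgue measure may have infinite `μ_α` measure, and then `χ_S f` need not be
integrable. Truncating `S` brings the integral formula back. -/
theorem tendsto_projE_inter_Iic (α : ℝ) {S : Set ℝ} (hS : MeasurableSet S) (f : L2 α) :
    Tendsto (fun n : ℕ => projE α (S ∩ Set.Iic (n : ℝ)) (hS.inter measurableSet_Iic) f) atTop
      (𝓝 (projE α S hS f)) := by
  -- For the finite measure `|f|² dμ_α`, the squared norm of the discarded tail is the measure of a
  -- set decreasing to `∅`.
  set ν := (muAlpha α).withDensity fun x => ‖f x‖ₑ ^ 2
  have hν : ν Set.univ ≠ ⊤ := by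
    rw [withDensity_apply _ MeasurableSet.univ, setLIntegral_univ, ← enorm_sq_eq_lintegral]
    exact ENNReal.pow_ne_top enorm_ne_top
  have hm (n : ℕ) : MeasurableSet (S ∩ Set.Ioi (n : ℝ)) := hS.inter measurableSet_Ioi
  have hsplit (n : ℕ) :
      projE α S hS f - projE α (S ∩ Set.Iic (n : ℝ)) (hS.inter measurableSet_Iic) f =
        projE α (S ∩ Set.Ioi (n : ℝ)) (hm n) f := by
    refine Lp.ext ?_
    filter_upwards [Lp.coeFn_sub (projE α S hS f)
      (projE α (S ∩ Set.Iic (n : ℝ)) (hS.inter measurableSet_Iic) f), coeFn_projE α hS f,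
      coeFn_projE α (hS.inter (measurableSet_Iic (a := (n : ℝ)))) f,
      coeFn_projE α (hm n) f] with x h1 h2 h3 h4
    rw [h1, Pi.sub_apply, h2, h3, h4]
    by_cases h : x ∈ S <;> by_cases h' : x ≤ n <;> simp [h, h', Set.indicator]
  have hlim : Tendsto (fun n : ℕ => ν (S ∩ Set.Ioi (n : ℝ))) atTop (𝓝 0) := by
    have := tendsto_measure_iInter_atTop (μ := ν) (s := fun n : ℕ => S ∩ Set.Ioi (n : ℝ))
      (fun n => (hm n).nullMeasurableSet)
      (fun m n hmn => Set.inter_subset_inter_right _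
        (Set.Ioi_subset_Ioi (by exact_mod_cast hmn)))
      ⟨0, ne_top_of_le_ne_top hν (measure_mono (Set.subset_univ _))⟩
    have hempty : ⋂ n : ℕ, S ∩ Set.Ioi (n : ℝ) = ∅ := by
      refine Set.eq_empty_of_forall_notMem fun x hx => ?_
      obtain ⟨n, hn⟩ := exists_nat_ge x
      exact absurd (Set.mem_iInter.1 hx n).2 (not_lt.2 hn)
    rwa [hempty, measure_empty] at this
  have hsq (n : ℕ) : ‖projE α (S ∩ Set.Ioi (n : ℝ)) (hm n) f‖ₑ =
      (ν (S ∩ Set.Ioi (n : ℝ))) ^ (1 / 2 : ℝ) := by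
    rw [withDensity_apply _ (hm n), ← enorm_projE_sq α (hm n), ← ENNReal.rpow_two, ← ENNReal.rpow_mul]
    norm_num
  rw [tendsto_iff_edist_tendsto_0]
  have h0 := (ENNReal.continuous_rpow_const (y := (1 / 2 : ℝ))).tendsto 0 |>.comp hlim
  rw [ENNReal.zero_rpow_of_pos (by norm_num)] at h0
  refine h0.congr fun n => ?_
  rw [edist_comm, edist_eq_enorm_sub, hsplit, hsq, Function.comp_apply]

theorem muAlpha_Iic_lt_top {α : ℝ} (hα : -1 / 2 < α) (n : ℕ) : muAlpha α (Set.Iic (n : ℝ)) < ⊤ := by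
  rw [muAlpha, withDensity_apply _ measurableSet_Iic,
    Measure.restrict_restrict measurableSet_Iic, Set.inter_comm, Set.Ioi_inter_Iic]
  calc _ ≤ ∫⁻ _ in Set.Ioc (0 : ℝ) n,
        ENNReal.ofReal ((2 * Real.pi) ^ (α + 1) * (n : ℝ) ^ (2 * α + 1)) := by
        refine setLIntegral_mono measurable_const fun x hx => ENNReal.ofReal_le_ofReal ?_
        have := hx.1
        gcongr
        · linarith
        · exact hx.2
    _ < ⊤ := by
        rw [setLIntegral_const, Real.volume_Ioc]
        exact ENNReal.mul_lt_top ENNReal.ofReal_lt_top ENNReal.ofReal_lt_top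

/-! ### The Hilbert-Schmidt estimate -/

/-- The weight cancels the density of `μ_α`; this is where Lebesgue measure enters. -/
theorem setLIntegral_rpow_muAlpha_le (α C : ℝ) {S : Set ℝ}
    (hS : MeasurableSet S) :
    ∫⁻ x in S, ENNReal.ofReal (C * x ^ (-(2 * α + 1))) ∂(muAlpha α) ≤
      ENNReal.ofReal (C * (2 * Real.pi) ^ (α + 1)) * volume S := by
  rw [muAlpha, setLIntegral_withDensity_eq_setLIntegral_mul _ (measurable_muAlpha_density α)
    (by fun_prop) hS]
  calc _ = ∫⁻ _ in S, ENNReal.ofReal (C * (2 * Real.pi) ^ (α + 1))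
          ∂(volume.restrict (Set.Ioi (0 : ℝ))) := by
        refine lintegral_congr_ae (ae_restrict_of_ae ?_)
        filter_upwards [ae_restrict_mem (measurableSet_Ioi (a := (0 : ℝ)))] with x hx
        have hx : 0 < x := hx
        rw [Pi.mul_apply, ← ENNReal.ofReal_mul (by positivity), Real.rpow_neg hx.le]
        have : x ^ (2 * α + 1) ≠ 0 := by positivity
        congr 1
        field_simp
    _ ≤ _ := by
        rw [setLIntegral_const]
        gcongr
        exact Measure.restrict_le_self

theorem enorm_besselj_sq_le {α κ : ℝ} (hκ : BesselBound α κ) {t : ℝ} (ht : 0 < t) :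
    ‖(besselj α t : ℂ)‖ₑ ^ 2 ≤ ENNReal.ofReal (κ ^ 2 * t ^ (-(2 * α + 1))) := by
  rw [← ofReal_norm, Complex.norm_real, Real.norm_eq_abs,
    ← ENNReal.ofReal_pow (abs_nonneg _)]
  refine ENNReal.ofReal_le_ofReal ((pow_le_pow_left₀ (abs_nonneg _) (hκ t ht) 2).trans_eq ?_)
  rw [mul_pow, ← Real.rpow_mul_natCast ht.le]
  congr 2
  push_cast
  ring

theorem setLIntegral_besselj_sq_le {α κ : ℝ} (hκ : BesselBound α κ) {S : Set ℝ}
    (hS : MeasurableSet S) {y : ℝ} (hy : 0 < y) :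
    ∫⁻ x in S, ‖(besselj α (2 * Real.pi * x * y) : ℂ)‖ₑ ^ 2 ∂(muAlpha α) ≤
      ENNReal.ofReal (κ ^ 2 * (2 * Real.pi) ^ (-α) * y ^ (-(2 * α + 1))) * volume S := by
  have hπ : 0 < 2 * Real.pi := by positivity
  calc _ ≤ ∫⁻ x in S, ENNReal.ofReal (κ ^ 2 * (2 * Real.pi * y) ^ (-(2 * α + 1)) *
          x ^ (-(2 * α + 1))) ∂(muAlpha α) := by
        refine lintegral_mono_ae (ae_restrict_of_ae ?_)
        filter_upwards [ae_muAlpha_pos α] with x hx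
        refine (enorm_besselj_sq_le hκ (by positivity)).trans_eq ?_
        rw [mul_right_comm _ x, Real.mul_rpow (by positivity) hx.le, ← mul_assoc]
    _ ≤ _ := setLIntegral_rpow_muAlpha_le α _ hS
    _ = _ := by
        rw [Real.mul_rpow hπ.le hy.le, show -α = -(2 * α + 1) + (α + 1) by ring,
          Real.rpow_add hπ (-(2 * α + 1))]
        congr 2
        ring

/-- For almost every `y`, the transform of `χ_S v_i` at `y` is the inner product of `v_i` with the
kernel row `χ_S j_α(2π · y)`. Bessel's inequality bounds the sum over `i` by the squared norm of
that row, which is then integrated over `T`. -/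
theorem sum_enorm_projE_fourierBessel_sq_le_of_measure_lt_top {α κ : ℝ} (hα : -1 / 2 < α)
    (hκ : BesselBound α κ) {S T : Set ℝ} (hS : MeasurableSet S) (hT : MeasurableSet T)
    (hμS : muAlpha α S < ⊤) (hvS : volume S ≠ ⊤) {ι : Type*} {v : ι → L2 α}
    (hv : Orthonormal ℂ v) (s : Finset ι) :
    ∑ i ∈ s, ‖projE α T hT (fourierBessel α (projE α S hS (v i)))‖ₑ ^ 2 ≤
      ENNReal.ofReal (κ ^ 2 * (2 * Real.pi)) * volume S * volume T := by
  have hπ : 0 < 2 * Real.pi := by positivity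
  have hU (i : ι) : (fourierBessel α (projE α S hS (v i)) : ℝ → ℂ) =ᵐ[muAlpha α]
      fourierBesselIntegral α (projE α S hS (v i)) := by
    refine isFourierBessel_fourierBessel hα _ ?_
    have : IsFiniteMeasure ((muAlpha α).restrict S) := ⟨by simpa using hμS⟩
    have h1 : IntegrableOn (v i) S (muAlpha α) :=
      ((Lp.memLp (v i)).restrict S).integrable one_le_two
    exact (h1.integrable_indicator hS).congr (coeFn_projE α hS (v i)).symm
  have hbound : ∀ᵐ y ∂(muAlpha α),
      ∑ i ∈ s, ‖(fourierBessel α (projE α S hS (v i)) : ℝ → ℂ) y‖ₑ ^ 2 ≤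
        ENNReal.ofReal (κ ^ 2 * (2 * Real.pi) ^ (-α) * y ^ (-(2 * α + 1))) * volume S := by
    have hU' := (ae_ball_iff s.countable_toSet).2 fun i _ => hU i
    filter_upwards [hU', ae_muAlpha_pos α] with y hy hy0
    have hker := setLIntegral_besselj_sq_le hκ hS hy0
    set k : ℝ → ℂ := S.indicator fun x => (besselj α (2 * Real.pi * x * y) : ℂ) with hk
    have hk_sq : ∫⁻ x, ‖k x‖ₑ ^ 2 ∂(muAlpha α) =
        ∫⁻ x in S, ‖(besselj α (2 * Real.pi * x * y) : ℂ)‖ₑ ^ 2 ∂(muAlpha α) := by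
      rw [← lintegral_indicator hS]
      congr 1 with x
      by_cases h : x ∈ S <;> simp [hk, h]
    have hkmeas : AEStronglyMeasurable k (muAlpha α) := by
      have := continuous_besselj hα
      exact (Continuous.aestronglyMeasurable (by fun_prop)).indicator hS
    have hkmem : MemLp k 2 (muAlpha α) := by
      refine ⟨hkmeas, ?_⟩
      rw [eLpNorm_lt_top_iff_lintegral_rpow_enorm_lt_top two_ne_zero ENNReal.ofNat_ne_top]
      simp only [ENNReal.toReal_ofNat, ENNReal.rpow_two]
      rw [hk_sq]
      exact hker.trans_lt (ENNReal.mul_lt_top ENNReal.ofReal_lt_top hvS.lt_top)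
    have hcoef (i : ι) (hi : i ∈ s) : ‖(fourierBessel α (projE α S hS (v i)) : ℝ → ℂ) y‖ₑ ^ 2 =
        ENNReal.ofReal (‖inner ℂ (v i) (hkmem.toLp k)‖ ^ 2) := by
      have h1 : (fourierBessel α (projE α S hS (v i)) : ℝ → ℂ) y =
          inner ℂ (hkmem.toLp k) (v i) := by
        rw [hy i hi, fourierBesselIntegral, L2.inner_def]
        refine integral_congr_ae ?_
        filter_upwards [coeFn_projE α hS (v i), hkmem.coeFn_toLp] with x h1 h2
        rw [h1, h2, RCLike.inner_apply, hk]
        by_cases h : x ∈ S <;> simp [h]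
      rw [h1, ← inner_conj_symm, RCLike.enorm_conj, ENNReal.ofReal_pow (norm_nonneg _),
        ofReal_norm]
    rw [Finset.sum_congr rfl hcoef, ← ENNReal.ofReal_sum_of_nonneg fun _ _ => by positivity]
    calc _ ≤ ENNReal.ofReal (‖hkmem.toLp k‖ ^ 2) :=
          ENNReal.ofReal_le_ofReal (hv.sum_inner_products_le _)
      _ = ∫⁻ x, ‖k x‖ₑ ^ 2 ∂(muAlpha α) := by
          rw [ENNReal.ofReal_pow (norm_nonneg _), ofReal_norm, enorm_sq_eq_lintegral]
          refine lintegral_congr_ae ?_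
          filter_upwards [hkmem.coeFn_toLp] with x hx
          rw [hx]
      _ ≤ _ := hk_sq ▸ hker
  simp only [enorm_projE_sq]
  rw [← lintegral_finsetSum' _ fun i _ =>
    ((Lp.aestronglyMeasurable _).enorm.pow_const 2).restrict]
  calc _ ≤ ∫⁻ y in T, ENNReal.ofReal (κ ^ 2 * (2 * Real.pi) ^ (-α) * y ^ (-(2 * α + 1))) *
          volume S ∂(muAlpha α) := lintegral_mono_ae (ae_restrict_of_ae hbound)
    _ = (∫⁻ y in T, ENNReal.ofReal (κ ^ 2 * (2 * Real.pi) ^ (-α) * y ^ (-(2 * α + 1)))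
          ∂(muAlpha α)) * volume S := lintegral_mul_const _ (by fun_prop)
    _ ≤ ENNReal.ofReal (κ ^ 2 * (2 * Real.pi) ^ (-α) * (2 * Real.pi) ^ (α + 1)) * volume T *
          volume S := by
        gcongr
        exact setLIntegral_rpow_muAlpha_le α _ hT
    _ = _ := by
        rw [mul_assoc (κ ^ 2), ← Real.rpow_add hπ, show -α + (α + 1) = 1 by ring, Real.rpow_one,
          mul_right_comm]

/-- The truncated sets satisfy the bound uniformly, since their Lebesgue measure is at most `|S|`,
and finite sums pass to the limit. -/
theorem sum_enorm_projF_projE_sq_le {α κ : ℝ} (hα : -1 / 2 < α)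
    (hκ : BesselBound α κ) {S T : Set ℝ} (hS : MeasurableSet S) (hT : MeasurableSet T)
    (hvS : volume S ≠ ⊤) (hvT : volume T ≠ ⊤) {ι : Type*} {v : ι → L2 α}
    (hv : Orthonormal ℂ v) (s : Finset ι) :
    ∑ i ∈ s, ‖projF α T hT (projE α S hS (v i))‖ₑ ^ 2 ≤
      ENNReal.ofReal (κ * √(2 * Real.pi * (volume.real S * volume.real T))) ^ 2 := by
  have hκ0 : 0 ≤ κ := by simpa using (abs_nonneg _).trans (hκ 1 one_pos)
  have hrhs : ENNReal.ofReal (κ * √(2 * Real.pi * (volume.real S * volume.real T))) ^ 2 =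
      ENNReal.ofReal (κ ^ 2 * (2 * Real.pi)) * volume S * volume T := by
    rw [← ENNReal.ofReal_pow (by positivity), mul_pow, Real.sq_sqrt (by positivity),
      ← ENNReal.ofReal_toReal hvS, ← ENNReal.ofReal_toReal hvT, ← ENNReal.ofReal_mul
      (by positivity), ← ENNReal.ofReal_mul (by positivity)]
    simp only [Measure.real]
    congr 1
    ring
  have hlim : Tendsto (fun n : ℕ => ∑ i ∈ s, ‖projF α T hT
      (projE α (S ∩ Set.Iic (n : ℝ)) (hS.inter measurableSet_Iic) (v i))‖ₑ ^ 2) atTop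
      (𝓝 (∑ i ∈ s, ‖projF α T hT (projE α S hS (v i))‖ₑ ^ 2)) := by
    refine tendsto_finsetSum _ fun i _ => ?_
    have h1 := ((projF α T hT).continuous.tendsto _).comp (tendsto_projE_inter_Iic α hS (v i))
    exact ((ENNReal.continuous_pow 2).tendsto _).comp ((continuous_enorm.tendsto _).comp h1)
  rw [hrhs]
  refine le_of_tendsto' hlim fun n => ?_
  have hsub : volume (S ∩ Set.Iic (n : ℝ)) ≤ volume S := measure_mono Set.inter_subset_left
  have henorm (f : L2 α) : ‖projF α T hT f‖ₑ = ‖projE α T hT (fourierBessel α f)‖ₑ := by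
    rw [← ofReal_norm, norm_projF, ofReal_norm]
  simp only [henorm]
  refine (sum_enorm_projE_fourierBessel_sq_le_of_measure_lt_top hα hκ
    (hS.inter measurableSet_Iic) hT
    ((measure_mono Set.inter_subset_right).trans_lt (muAlpha_Iic_lt_top hα n))
    (ne_top_of_le_ne_top hvS hsub) hv s).trans ?_
  gcongr

theorem norm_projF_projE_le {α κ : ℝ} (hα : -1 / 2 < α)
    (hκ : BesselBound α κ) {S T : Set ℝ} (hS : MeasurableSet S) (hT : MeasurableSet T)
    (hvS : volume S ≠ ⊤) (hvT : volume T ≠ ⊤) (f : L2 α) :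
    ‖projF α T hT (projE α S hS f)‖ ≤
      κ * √(2 * Real.pi * (volume.real S * volume.real T)) * ‖f‖ := by
  have hκ0 : 0 ≤ κ := by simpa using (abs_nonneg _).trans (hκ 1 one_pos)
  rcases eq_or_ne f 0 with rfl | hf
  · simp
  have hf0 : 0 < ‖f‖ := norm_pos_iff.2 hf
  set g : L2 α := ((‖f‖⁻¹ : ℝ) : ℂ) • f with hg
  have hg1 : ‖g‖ = 1 := by
    rw [hg, norm_smul, Complex.norm_real, norm_inv, norm_norm, inv_mul_cancel₀ hf0.ne']
  -- A single unit vector is an orthonormal family, so the bound on sums already contains the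
  -- operator norm bound.
  have hv : Orthonormal ℂ fun _ : Unit => g :=
    ⟨fun _ => hg1, fun i j hij => absurd (Subsingleton.elim i j) hij⟩
  have h := sum_enorm_projF_projE_sq_le hα hκ hS hT hvS hvT hv Finset.univ
  rw [Fintype.sum_unique, ← ofReal_norm, ← ENNReal.ofReal_pow (norm_nonneg _),
    ← ENNReal.ofReal_pow (by positivity), ENNReal.ofReal_le_ofReal_iff (by positivity)] at h
  have h2 := (sq_le_sq₀ (norm_nonneg _) (by positivity)).1 h
  rw [hg, map_smul, map_smul, norm_smul, Complex.norm_real, norm_inv, norm_norm,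
    inv_mul_le_iff₀ hf0] at h2
  linarith

theorem hilbertSchmidtNorm_projF_projE_le {α κ : ℝ} (hα : -1 / 2 < α)
    (hκ : BesselBound α κ) {S T : Set ℝ} (hS : MeasurableSet S) (hT : MeasurableSet T)
    (hvS : volume S ≠ ⊤) (hvT : volume T ≠ ⊤) {ι : Type*} (b : HilbertBasis ι ℂ (L2 α)) :
    hilbertSchmidtNorm b (projF α T hT ∘L projE α S hS) ≤
      ENNReal.ofReal (κ * √(2 * Real.pi * (volume.real S * volume.real T))) := by
  have h : ∑' i, ‖(projF α T hT ∘L projE α S hS) (b i)‖ₑ ^ 2 ≤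
      ENNReal.ofReal (κ * √(2 * Real.pi * (volume.real S * volume.real T))) ^ 2 := by
    rw [ENNReal.tsum_eq_iSup_sum]
    exact iSup_le fun s => sum_enorm_projF_projE_sq_le hα hκ hS hT hvS hvT b.orthonormal s
  refine (ENNReal.rpow_le_rpow h (by norm_num : (0 : ℝ) ≤ 1 / 2)).trans_eq ?_
  rw [← ENNReal.rpow_two, ← ENNReal.rpow_mul]
  norm_num

/-! ### From the norm bound to the uncertainty inequality -/

/-- Split `E_S f = F_T E_S f + F_{T^c} E_S f`. The first term is at most `c ‖E_S f‖` and is absorbed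
on the left; in the second, `E_S f = f - E_{S^c} f`. -/
theorem norm_le_of_norm_projF_projE_le {α c : ℝ} (hc : c < 1) {S T : Set ℝ}
    (hS : MeasurableSet S) (hT : MeasurableSet T) (f : L2 α)
    (h : ‖projF α T hT (projE α S hS (projE α S hS f))‖ ≤ c * ‖projE α S hS f‖) :
    ‖f‖ ≤ (1 + 1 / (1 - c)) * (‖projE α (Set.Ici 0 \ S) (measurableSet_Ici.diff hS) f‖ +
      ‖projF α (Set.Ici 0 \ T) (measurableSet_Ici.diff hT) f‖) := by
  -- The bound is taken at `E_S f` rather than `f`, so that `c` multiplies `‖E_S f‖` and can be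
  -- absorbed.
  have hidem : projE α S hS (projE α S hS f) = projE α S hS f := by
    refine Lp.ext ?_
    filter_upwards [coeFn_projE α hS f, coeFn_projE α hS (projE α S hS f)] with x h1 h2
    rw [h2]
    by_cases hx : x ∈ S <;> simp [hx, h1]
  rw [hidem] at h
  set Ec := projE α (Set.Ici 0 \ S) (measurableSet_Ici.diff hS)
  set Fc := projF α (Set.Ici 0 \ T) (measurableSet_Ici.diff hT)
  have hE : projE α S hS f + Ec f = f := projE_add_projE_compl α hS f
  have h1 : ‖f‖ ≤ ‖projE α S hS f‖ + ‖Ec f‖ := by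
    conv_lhs => rw [← hE]
    exact norm_add_le _ _
  have h2 : ‖projE α S hS f‖ ≤ ‖projF α T hT (projE α S hS f)‖ + ‖Fc (projE α S hS f)‖ := by
    conv_lhs => rw [← projF_add_projF_compl α hT (projE α S hS f)]
    exact norm_add_le _ _
  have h3 : ‖Fc (projE α S hS f)‖ ≤ ‖Fc f‖ + ‖Ec f‖ := by
    rw [eq_sub_of_add_eq hE, map_sub]
    refine (norm_sub_le _ _).trans ?_
    gcongr
    exact norm_projF_le α _ _
  have hc' : 0 < 1 - c := by linarith
  have h4 : ‖projE α S hS f‖ ≤ 1 / (1 - c) * (‖Ec f‖ + ‖Fc f‖) := by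
    rw [one_div_mul_eq_div, le_div_iff₀ hc']
    linarith
  have := norm_nonneg (Fc f)
  linarith

end FourierBessel

end

theorem lemma4p2 (α : ℝ) (hα : -1 / 2 < α) :
    (∃ κ : ℝ, FourierBessel.BesselBound α κ) ∧
    ∀ κ : ℝ, FourierBessel.BesselBound α κ →
      ∀ (S T : Set ℝ) (hS : MeasurableSet S) (hT : MeasurableSet T),
        S ⊆ Set.Ici 0 → T ⊆ Set.Ici 0 → volume S ≠ ⊤ → volume T ≠ ⊤ →
        (∀ (ι : Type*) (b : HilbertBasis ι ℂ (FourierBessel.L2 α)),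
          FourierBessel.hilbertSchmidtNorm b
              (FourierBessel.projF α T hT ∘L FourierBessel.projE α S hS) ≤
            ENNReal.ofReal (κ * √(2 * Real.pi * (volume.real S * volume.real T)))) ∧
        (volume.real S * volume.real T < (2 * Real.pi)⁻¹ * κ ^ (-2 : ℤ) →
          ∀ f : FourierBessel.L2 α,
            ‖f‖ ≤ (1 + 1 / (1 - κ * √(2 * Real.pi * (volume.real S * volume.real T)))) *
              (‖FourierBessel.projE α (Set.Ici 0 \ S) (measurableSet_Ici.diff hS) f‖ +
                ‖FourierBessel.projF α (Set.Ici 0 \ T) (measurableSet_Ici.diff hT) f‖)) := by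
  refine ⟨FourierBessel.exists_besselBound hα, fun κ hκ S T hS hT _ _ hvS hvT => ⟨fun ι b =>
    FourierBessel.hilbertSchmidtNorm_projF_projE_le hα hκ hS hT hvS hvT b, fun h f => ?_⟩⟩
  have hκ0 : 0 ≤ κ := by simpa using (abs_nonneg _).trans (hκ 1 one_pos)
  -- With the convention `0⁻¹ = 0`, the value `κ = 0` would turn `h` into a nonnegative number being
  -- less than 0.
  have hκ_ne : κ ≠ 0 := by
    rintro rfl
    rw [zero_zpow _ (by norm_num), mul_zero] at h
    exact absurd h (not_lt.2 (by positivity))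
  refine FourierBessel.norm_le_of_norm_projF_projE_le ?_ hS hT f
    (FourierBessel.norm_projF_projE_le hα hκ hS hT hvS hvT _)
  have hπ := Real.pi_pos
  have hκ_pos : 0 < κ := lt_of_le_of_ne hκ0 hκ_ne.symm
  rw [← sq_lt_one_iff₀ (by positivity), mul_pow, Real.sq_sqrt (by positivity)]
  rw [zpow_neg, ← mul_inv, ← one_div, lt_div_iff₀ (by positivity)] at h
  calc _ = volume.real S * volume.real T * (2 * Real.pi * κ ^ (2 : ℤ)) := by
        norm_cast
        ring
    _ < 1 := h
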